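/- **Setting.** Let $1\le k\le n-1$. For $\lambda\in\mathbb R^n$ let $S_k(\lambda)=\sum_{i_1<\dots<i_k}\lambda_{i_1}\cdots\lambda_{i_k}$, let $\Gamma_k$ be the connected component of $\{\lambda\in\mathbb R^n: S_k(\lambda)>0\}$ containing the positive cone $\{\lambda:\lambda_i>0\ \forall i\}$, and for a real symmetric matrix $A$ let $S_k(A)=S_k(\lambda(A))$, where $\lambda(A)$ is the vector of eigenvalues of $A$. A function $u\in C^2(\Omega)$ is *$k$-convex* (*strictly $k$-convex*) in $\Omega$ if $\lambda(D^2u(x))\in\overline{\Gamma_k}$ ($\in\Gamma_k$) for every $x\in\Omega$. We write $u=+\infty$ on $\partial\Omega$ if $u(x)\to+\infty$ as $x\in\Omega$, $\operatorname{dist}(x,\partial\Omega)\to0$. **Theorem.** Let $\Omega\subset\mathbb R^n$ be a bounded domain, star-shaped with respect to a point $x_0$ in the sense that $x_0+t(x-x_0)\in\Omega$ for all $x\in\overline\Omega$ and $0\le t<1$. Let $\psi=\psi(x,z,p)\in C^1(\Omega\times\mathbb R\times\mathbb R^n)$ satisfy $$(x-x_0)\cdot D_x\psi(x,z,p)\le0,\qquad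 p\cdot D_p\psi(x,z,p)\ge0\qquad\text{on }\Omega\times\mathbb R\times\mathbb R^n,$$ and suppose that either there is a real $q>k$ with $$\psi(x,\mu z^+,p)\ge\mu^q\,\psi(x,z,p)\qquad\text{for all }\mu\ge1,\ (x,z,p)\in\Omega\times\mathbb R\times\mathbb R^n,$$ where $z^+=\max\{z,0\}$, or there is an $\varepsilon>0$ with $$\psi_z(x,z,p)\ge\varepsilon\,\psi(x,z,p)\qquad\text{for all }(x,z,p)\in\Omega\times\mathbb R\times\mathbb R^n.$$ 1. Let $\phi\in C^1(\Omega\times\mathbb R\times\mathbb R^n)$ with $\phi\le\psi$, let $u\in C^2(\Omega)$ be $k$-convex and $v\in C^2(\Omega)$ strictly $k$-convex, with $u=+\infty$ and $v=+\infty$ on $\partial\Omega$, and $$S_k(D^2u)\ge\psi(x,u,Du),\qquad S_k(D^2v)\le\phi(x,v,Dv)\qquad\text{in }\Omega.$$ Then $u\le v$ in $\Omega$. 2. In particular, the problem $S_k(D^2u)=\psi(x,u,Du)$ in $\Omega$, $u=+\infty$ on $\partial\Omega$, has at most one strictly $k$-convex solution $u\in C^2(\Omega)$. -/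

import Mathlib

/-- Euclidean `n`-space. -/
abbrev Euc (n : ℕ) : Type := EuclideanSpace ℝ (Fin n)

/-- The `k`-th elementary symmetric function of `l = (l₁, …, lₙ)`. -/
noncomputable def elemSymm {n : ℕ} (k : ℕ) (l : Fin n → ℝ) : ℝ :=
  ∑ s ∈ (Finset.univ : Finset (Fin n)).powersetCard k, ∏ i ∈ s, l i

/-- The cone `Γ_k`: the connected component of `{l | S_k(l) > 0}` containing the positive cone,
i.e. the component of the point `(1, …, 1)`. -/
def gammaCone (n k : ℕ) : Set (Fin n → ℝ) :=
  connectedComponentIn {l : Fin n → ℝ | 0 < elemSymm k l} (fun _ => 1)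

open Classical in
/-- The eigenvalues, with multiplicity, of a real symmetric matrix
(value `0` for a matrix that is not symmetric). -/
noncomputable def eigenvaluesOf {n : ℕ} (A : Matrix (Fin n) (Fin n) ℝ) : Fin n → ℝ :=
  if h : A.IsHermitian then h.eigenvalues else 0

/-- `S_k(A) = S_k(λ₁, …, λₙ)`, where the `λᵢ` are the eigenvalues of the symmetric matrix `A`. -/
noncomputable def matSymm {n : ℕ} (k : ℕ) (A : Matrix (Fin n) (Fin n) ℝ) : ℝ :=
  elemSymm k (eigenvaluesOf A)

/-- The Hessian matrix `D²u(x)` of second partial derivatives. -/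
noncomputable def hessianMat {n : ℕ} (u : Euc n → ℝ) (x : Euc n) : Matrix (Fin n) (Fin n) ℝ :=
  Matrix.of fun i j =>
    fderiv ℝ (fderiv ℝ u) x (EuclideanSpace.single i 1) (EuclideanSpace.single j 1)

/-- The Hessian matrix of a `C²` function is symmetric, so `eigenvaluesOf` never takes its
default value on it. -/
theorem hessianMat_isHermitian {n : ℕ} {u : Euc n → ℝ} {Ω : Set (Euc n)} (hΩ : IsOpen Ω)
    (hu : ContDiffOn ℝ 2 u Ω) {x : Euc n} (hx : x ∈ Ω) : (hessianMat u x).IsHermitian := by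
  have h := (hu.contDiffAt (hΩ.mem_nhds hx)).isSymmSndFDerivAt (by simp)
  ext i j
  simpa [hessianMat] using h (EuclideanSpace.single j 1) (EuclideanSpace.single i 1)

/-- `u ∈ C²(Ω)` is `k`-convex in `Ω`. -/
def KConvexOn {n : ℕ} (k : ℕ) (Ω : Set (Euc n)) (u : Euc n → ℝ) : Prop :=
  ContDiffOn ℝ 2 u Ω ∧ ∀ x ∈ Ω, eigenvaluesOf (hessianMat u x) ∈ closure (gammaCone n k)

/-- `u ∈ C²(Ω)` is strictly `k`-convex in `Ω`. -/
def StrictKConvexOn {n : ℕ} (k : ℕ) (Ω : Set (Euc n)) (u : Euc n → ℝ) : Prop :=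
  ContDiffOn ℝ 2 u Ω ∧ ∀ x ∈ Ω, eigenvaluesOf (hessianMat u x) ∈ gammaCone n k

/-- `u = +∞` on `∂Ω`: `u(x) → +∞` as `x ∈ Ω` and `d(x, ∂Ω) → 0`. -/
def BlowsUpAtBoundary {n : ℕ} (Ω : Set (Euc n)) (u : Euc n → ℝ) : Prop :=
  ∀ M : ℝ, ∃ δ > 0, ∀ x ∈ Ω, Metric.infDist x (frontier Ω) < δ → M < u x

/-- `f = f(x, z, p)` is of class `C¹` on `Ω × ℝ × ℝⁿ`. -/
def IsC1On {n : ℕ} (Ω : Set (Euc n)) (f : Euc n → ℝ → Euc n → ℝ) : Prop :=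
  ContDiffOn ℝ 1 (fun w : Euc n × ℝ × Euc n => f w.1 w.2.1 w.2.2) (Ω ×ˢ Set.univ)

/-- `Ω` is star-shaped with respect to `x₀`, in the sense that the half-open segment
from `x₀` to any point of the closure of `Ω` lies in `Ω`. -/
def StarShapedAt {n : ℕ} (Ω : Set (Euc n)) (x₀ : Euc n) : Prop :=
  ∀ x ∈ closure Ω, ∀ t : ℝ, 0 ≤ t → t < 1 → x₀ + t • (x - x₀) ∈ Ω

/-- `S_k(D²u) ≥ f(x, u, Du)` in `Ω`. -/
def IsSubsolution {n : ℕ} (k : ℕ) (Ω : Set (Euc n)) (f : Euc n → ℝ → Euc n → ℝ)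
    (u : Euc n → ℝ) : Prop :=
  ∀ x ∈ Ω, f x (u x) (gradient u x) ≤ matSymm k (hessianMat u x)

/-- `S_k(D²u) ≤ f(x, u, Du)` in `Ω`. -/
def IsSupersolution {n : ℕ} (k : ℕ) (Ω : Set (Euc n)) (f : Euc n → ℝ → Euc n → ℝ)
    (u : Euc n → ℝ) : Prop :=
  ∀ x ∈ Ω, matSymm k (hessianMat u x) ≤ f x (u x) (gradient u x)

/-- The blow-up problem: `S_k(D²u) = f(x, u, Du)` in `Ω` and `u = +∞` on `∂Ω`. -/
def SolvesBlowUpProblem {n : ℕ} (k : ℕ) (Ω : Set (Euc n)) (f : Euc n → ℝ → Euc n → ℝ)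
    (u : Euc n → ℝ) : Prop :=
  (∀ x ∈ Ω, matSymm k (hessianMat u x) = f x (u x) (gradient u x)) ∧ BlowsUpAtBoundary Ω u

/-! The comparison uses dilations. If `u > v` somewhere, then for `t < 1` near `1` the function
`w(x) = c(t) u(x₀ + t(x - x₀)) - d(t)` still exceeds `v` somewhere. It is continuous up to the
boundary while `v` blows up there, so `w - v` has a positive interior maximum at some `y`. With `z =
x₀ + t(y - x₀)`, the maximum gives `Dv(y) = c t Du(z)` and `c t² D²u(z) ≤ D²v(y)`, hence `(c t²)ᵏ
S_k(D²u(z)) ≤ S_k(D²v(y))`. The sign conditions on `D_x ψ` and `D_p ψ` give `ψ(y, u(z), Dv(y)) ≤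
ψ(z, u(z), Du(z))`. The growth of `ψ` in its second argument outweighs `(c t²)ᵏ`, which is a
contradiction. Power growth calls for `c = t^β`, `d = 0`; exponential growth for `c = 1`, `d =
-(2k/ε) log t`. The algebraic input is the monotonicity of `S_k` on the closure of `Γ_k`. It rests
on Newton's inequality, which comes from Laguerre's inequality for derivatives of `∏ (X + lᵢ)`, and
passes to matrices by Weyl's principle. -/

/-! ### Real-rooted polynomials. -/

/-- The derivative of a real polynomial with only real roots has only real roots. -/
theorem splits_derivative_real {p : Polynomial ℝ} (hp : p.Splits) :
    (Polynomial.derivative p).Splits := by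
  rw [Polynomial.splits_iff_card_roots] at hp ⊢
  -- Rolle with multiplicities: at most one root is lost, and the degree also drops by at least one.
  have h1 := Polynomial.card_roots_le_derivative p
  have h2 := Polynomial.card_roots' (Polynomial.derivative p)
  have h3 := Polynomial.natDegree_derivative_le p
  rcases Nat.eq_zero_or_pos p.natDegree with h0 | h0
  · omega
  · omega

theorem splits_iterate_derivative_real {p : Polynomial ℝ} (hp : p.Splits) (m : ℕ) :
    (Polynomial.derivative^[m] p).Splits := by
  induction m with
  | zero => simpa using hp
  | succ m ih =>
    rw [Function.iterate_succ_apply']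
    exact splits_derivative_real ih

/-- The Laguerre inequality for real polynomials with only real roots. -/
theorem laguerre_of_splits {p : Polynomial ℝ} (hp : p.Splits) (x : ℝ) :
    p.eval x * (Polynomial.derivative (Polynomial.derivative p)).eval x
      ≤ (Polynomial.derivative p).eval x ^ 2 := by
  obtain ⟨m, hm⟩ := Polynomial.splits_iff_exists_multiset.1 hp
  rw [hm]
  generalize p.leadingCoeff = c
  clear hm hp
  suffices h : ∀ m : Multiset ℝ,
      (m.map (Polynomial.X - Polynomial.C ·)).prod.eval x *
        (Polynomial.derivative (Polynomial.derivative
          (m.map (Polynomial.X - Polynomial.C ·)).prod)).eval x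
      ≤ (Polynomial.derivative (m.map (Polynomial.X - Polynomial.C ·)).prod).eval x ^ 2 by
    have := mul_le_mul_of_nonneg_left (h m) (sq_nonneg c)
    simp only [Polynomial.derivative_C_mul, Polynomial.eval_mul, Polynomial.eval_C] at this ⊢
    linarith
  intro m
  induction m using Multiset.induction with
  | empty => simp
  | cons a m ih =>
    simp only [Multiset.map_cons, Multiset.prod_cons]
    generalize (m.map (Polynomial.X - Polynomial.C ·)).prod = q at ih ⊢
    simp only [Polynomial.derivative_mul, Polynomial.derivative_add, Polynomial.derivative_sub,
      Polynomial.derivative_X, Polynomial.derivative_C, Polynomial.eval_add, Polynomial.eval_mul,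
      Polynomial.eval_sub, Polynomial.eval_X, Polynomial.eval_C, sub_zero, one_mul]
    -- The gap for `(X - a) q` is `q² + (x - a)²` times the gap for `q`.
    nlinarith [mul_le_mul_of_nonneg_left ih (sq_nonneg (x - a)), sq_nonneg (q.eval x)]

/-- A monic polynomial with only negative roots has positive coefficients up to its degree. -/
theorem coeff_prod_X_sub_C_of_neg (m : Multiset ℝ) (hm : ∀ a ∈ m, a < 0) :
    (∀ j, 0 ≤ (m.map (Polynomial.X - Polynomial.C ·)).prod.coeff j) ∧
      ∀ j ≤ Multiset.card m, 0 < (m.map (Polynomial.X - Polynomial.C ·)).prod.coeff j := by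
  induction m using Multiset.induction with
  | empty =>
    refine ⟨fun j => ?_, fun j hj => ?_⟩
    · simp only [Multiset.map_zero, Multiset.prod_zero, Polynomial.coeff_one]
      split_ifs <;> norm_num
    · simp at hj
      simp [hj]
  | cons a m ih =>
    have ha := hm a (Multiset.mem_cons_self a m)
    obtain ⟨h0, h1⟩ := ih fun b hb => hm b (Multiset.mem_cons_of_mem hb)
    simp only [Multiset.map_cons, Multiset.prod_cons, Multiset.card_cons]
    generalize (m.map (Polynomial.X - Polynomial.C ·)).prod = q at h0 h1 ⊢
    have hz : ((Polynomial.X - Polynomial.C a) * q).coeff 0 = -a * q.coeff 0 := by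
      simp [sub_mul]
    have hs (j : ℕ) : ((Polynomial.X - Polynomial.C a) * q).coeff (j + 1)
        = q.coeff j + -a * q.coeff (j + 1) := by
      simp [sub_mul, Polynomial.coeff_X_mul]
      ring
    have hna : 0 < -a := by linarith
    refine ⟨fun j => ?_, fun j hj => ?_⟩
    · cases j with
      | zero => rw [hz]; exact mul_nonneg hna.le (h0 0)
      | succ j => rw [hs]; exact add_nonneg (h0 j) (mul_nonneg hna.le (h0 _))
    · cases j with
      | zero => rw [hz]; exact mul_pos hna (h1 0 (Nat.zero_le _))
      | succ j =>
        rw [hs]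
        exact add_pos_of_pos_of_nonneg (h1 j (by omega)) (mul_nonneg hna.le (h0 _))

/-- A real-rooted polynomial with nonnegative coefficients and nonzero constant term has positive
coefficients up to its degree. -/
theorem coeff_pos_of_splits {p : Polynomial ℝ} (hp : p.Splits) (h0 : ∀ j, 0 ≤ p.coeff j)
    (hc : 0 < p.coeff 0) {j : ℕ} (hj : j ≤ p.natDegree) : 0 < p.coeff j := by
  have hp0 : p ≠ 0 := by rintro rfl; simp at hc
  have hroots : ∀ a ∈ p.roots, a < 0 := by
    intro a ha
    by_contra! hna
    have hr : p.eval a = 0 := Polynomial.isRoot_of_mem_roots ha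
    rw [Polynomial.eval_eq_sum_range, Finset.sum_range_succ'] at hr
    have : 0 ≤ ∑ i ∈ Finset.range p.natDegree, p.coeff (i + 1) * a ^ (i + 1) :=
      Finset.sum_nonneg fun i _ => mul_nonneg (h0 _) (pow_nonneg hna _)
    simp only [pow_zero, mul_one] at hr
    linarith
  have hlc : 0 < p.leadingCoeff :=
    lt_of_le_of_ne (h0 _) (Polynomial.leadingCoeff_ne_zero.2 hp0).symm
  rw [hp.eq_prod_roots, Polynomial.coeff_C_mul]
  refine mul_pos hlc ((coeff_prod_X_sub_C_of_neg _ hroots).2 j ?_)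
  rwa [← hp.natDegree_eq_card_roots]

/-! ### Elementary symmetric functions and the cone `Γ_k`. -/

/-- The `k`-th elementary symmetric function of the values of `l` on `s`. -/
noncomputable def esymOn {ι : Type*} (s : Finset ι) (l : ι → ℝ) (k : ℕ) : ℝ :=
  ∑ t ∈ s.powersetCard k, ∏ i ∈ t, l i

theorem esymOn_zero {ι : Type*} (s : Finset ι) (l : ι → ℝ) : esymOn s l 0 = 1 := by
  simp [esymOn]

theorem esymOn_insert {ι : Type*} [DecidableEq ι] {i : ι} {s : Finset ι} (hi : i ∉ s)
    (l : ι → ℝ) (k : ℕ) :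
    esymOn (insert i s) l (k + 1) = esymOn s l (k + 1) + l i * esymOn s l k := by
  unfold esymOn
  rw [Finset.powersetCard_succ_insert hi, Finset.sum_union, Finset.sum_image, Finset.mul_sum]
  · congr 1
    refine Finset.sum_congr rfl fun t ht => ?_
    rw [Finset.prod_insert]
    exact fun h => hi ((Finset.mem_powersetCard.1 ht).1 h)
  · intro t ht t' ht' h
    have h1 : i ∉ t := fun h => hi ((Finset.mem_powersetCard.1 ht).1 h)
    have h2 : i ∉ t' := fun h => hi ((Finset.mem_powersetCard.1 ht').1 h)
    rw [← Finset.erase_insert h1, ← Finset.erase_insert h2]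
    exact congrArg (fun u => u.erase i) h
  · rw [Finset.disjoint_left]
    intro t ht ht'
    obtain ⟨t', -, rfl⟩ := Finset.mem_image.1 ht'
    exact hi ((Finset.mem_powersetCard.1 ht).1 (Finset.mem_insert_self i t'))

theorem esymOn_congr {ι : Type*} {s : Finset ι} {l m : ι → ℝ} (h : ∀ i ∈ s, l i = m i) (k : ℕ) :
    esymOn s l k = esymOn s m k :=
  Finset.sum_congr rfl fun _ ht =>
    Finset.prod_congr rfl fun i hi => h i ((Finset.mem_powersetCard.1 ht).1 hi)

/-- The coefficients of the derivatives of `∏ (X + l i)` are elementary symmetric functions. -/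
theorem coeff_iterate_derivative_prod {ι : Type*} (s : Finset ι) (l : ι → ℝ) {k m : ℕ}
    (hk : k ≤ s.card) (hm : m ≤ k) :
    (Polynomial.derivative^[s.card - k]
        (∏ i ∈ s, (Polynomial.X + Polynomial.C (l i)))).coeff m
      = ((m + (s.card - k)).descFactorial (s.card - k) : ℝ) * esymOn s l (k - m) := by
  rw [Polynomial.coeff_iterate_derivative, Finset.prod_X_add_C_coeff _ _ (by omega), nsmul_eq_mul,
    show s.card - (m + (s.card - k)) = k - m by omega]
  rfl

theorem splits_prod_X_add_C {ι : Type*} (s : Finset ι) (l : ι → ℝ) :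
    (∏ i ∈ s, (Polynomial.X + Polynomial.C (l i))).Splits :=
  Polynomial.Splits.prod fun i _ => Polynomial.Splits.X_add_C (l i)

/-- Newton's inequality without the optimal constant. -/
theorem esymOn_newton {ι : Type*} (s : Finset ι) (l : ι → ℝ) (j : ℕ) :
    esymOn s l j * esymOn s l (j + 2) ≤ esymOn s l (j + 1) ^ 2 := by
  rcases lt_or_ge s.card (j + 2) with h | h
  · have : esymOn s l (j + 2) = 0 := by
      rw [esymOn, Finset.powersetCard_eq_empty.2 h, Finset.sum_empty]
    rw [this, mul_zero]
    positivity
  -- This derivative has lowest coefficients proportional to `S_{j+2}`, `S_{j+1}`, `S_j`, so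
  -- Laguerre's inequality at `0` relates exactly these three.
  · have hL := laguerre_of_splits
      (splits_iterate_derivative_real (splits_prod_X_add_C s l) (s.card - (j + 2))) 0
    simp only [← Polynomial.coeff_zero_eq_eval_zero, Polynomial.coeff_derivative] at hL
    rw [coeff_iterate_derivative_prod s l h (by omega),
      coeff_iterate_derivative_prod s l h (by omega),
      coeff_iterate_derivative_prod s l h (by omega)] at hL
    generalize s.card - (j + 2) = m at hL
    have e1 : ((0 + m).descFactorial m : ℝ) = m.factorial := by
      rw [zero_add, Nat.descFactorial_self]
    have e2 : ((0 + 1 + m).descFactorial m : ℝ) = (m + 1) * m.factorial := by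
      have := Nat.factorial_mul_descFactorial (show m ≤ 0 + 1 + m by omega)
      rw [show 0 + 1 + m - m = 1 by omega, show 0 + 1 + m = m + 1 by omega] at this
      rw [show 0 + 1 + m = m + 1 by omega]
      have h2 := congrArg (Nat.cast : ℕ → ℝ) this
      simp [Nat.factorial_succ] at h2
      simpa using h2
    have e3 : 2 * ((0 + 1 + 1 + m).descFactorial m : ℝ) = (m + 2) * ((m + 1) * m.factorial) := by
      have := Nat.factorial_mul_descFactorial (show m ≤ 0 + 1 + 1 + m by omega)
      rw [show 0 + 1 + 1 + m - m = 2 by omega, show 0 + 1 + 1 + m = m + 1 + 1 by omega] at this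
      rw [show 0 + 1 + 1 + m = m + 1 + 1 by omega]
      have h2 := congrArg (Nat.cast : ℕ → ℝ) this
      simp [Nat.factorial_succ] at h2
      simp only [h2]
      ring
    rw [e1, e2] at hL
    simp only [Nat.sub_zero, zero_add, show j + 2 - 1 = j + 1 by omega,
      show j + 2 - (1 + 1) = j by omega] at hL e3
    norm_num at hL
    set f : ℝ := (m.factorial : ℝ)
    have hf : 0 < f := by positivity
    set x := esymOn s l j
    set y := esymOn s l (j + 1)
    set z := esymOn s l (j + 2)
    set d := ((1 + 1 + m).descFactorial m : ℝ)
    -- Up to a positive factor, `(m + 2) S_j S_{j+2} ≤ (m + 1) S_{j+1}²`, which is stronger than the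
    -- claim.
    have hL' : f ^ 2 * (m + 1) * ((m + 2) * (x * z)) ≤ f ^ 2 * (m + 1) * ((m + 1) * y ^ 2) := by
      have : f ^ 2 * (m + 1) * ((m + 2) * (x * z)) = f * z * ((2 * d) * x) := by
        rw [e3]; ring
      rw [this]
      linarith
    have hL2 := le_of_mul_le_mul_left hL' (by positivity)
    have hm0 : (0 : ℝ) ≤ m := by positivity
    by_contra! hc
    nlinarith [sq_nonneg y]

/-- Deleting a variable from a point where `S₀, …, S_k` are positive leaves `S₀, …, S_{k-1}`
positive. -/
theorem esymOn_pos_of_insert {ι : Type*} [DecidableEq ι] {i : ι} {s : Finset ι} (hi : i ∉ s)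
    {l : ι → ℝ} {k : ℕ} (h : ∀ j ≤ k, 0 < esymOn (insert i s) l j) :
    ∀ j < k, 0 < esymOn s l j := by
  intro j
  induction j with
  | zero => intro _; simp [esymOn_zero]
  | succ j ih =>
    intro hj
    have hx := ih (by omega)
    have h1 := h (j + 1) (by omega)
    have h2 := h (j + 2) (by omega)
    rw [esymOn_insert hi] at h1 h2
    have hN := esymOn_newton s l j
    -- Write `x, y, z` for `S_j, S_{j+1}, S_{j+2}` on `s`. If `y ≤ 0`, then `y (y + lᵢ x) ≤ 0 < x (z
    -- + lᵢ y)`, hence `y² < x z`, against Newton.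
    by_contra! hy
    nlinarith [mul_pos hx h2, mul_nonneg (neg_nonneg.2 hy) h1.le]

/-- If `S₀, …, S_k` are nonnegative and `S_k` is positive, then all of them are positive. -/
theorem esymOn_pos_of_nonneg {ι : Type*} {s : Finset ι} {l : ι → ℝ} {k : ℕ} (hk : k ≤ s.card)
    (h : ∀ j ≤ k, 0 ≤ esymOn s l j) (hpos : 0 < esymOn s l k) : ∀ j ≤ k, 0 < esymOn s l j := by
  intro j hj
  -- `D` is real-rooted of degree `k`, its coefficient of `Xᵐ` being a positive multiple of
  -- `S_{k-m}`; the constant term carries `S_k > 0`.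
  set D := Polynomial.derivative^[s.card - k] (∏ i ∈ s, (Polynomial.X + Polynomial.C (l i)))
    with hD
  have hfac (m : ℕ) : (0 : ℝ) < (m + (s.card - k)).descFactorial (s.card - k) := by
    exact_mod_cast Nat.descFactorial_pos.2 (by omega)
  have hcoeff {m : ℕ} (hm : m ≤ k) := coeff_iterate_derivative_prod s l hk hm
  rw [← hD] at hcoeff
  have hdeg : D.natDegree = k := by
    refine Polynomial.natDegree_eq_of_le_of_coeff_ne_zero ?_ ?_
    · refine (Polynomial.natDegree_iterate_derivative _ _).trans ?_
      rw [Polynomial.natDegree_prod_of_monic _ _ fun i _ => Polynomial.monic_X_add_C _]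
      simp
      omega
    · rw [hcoeff le_rfl, Nat.sub_self, esymOn_zero, mul_one]
      exact (hfac k).ne'
  have hp := coeff_pos_of_splits (p := D)
    (splits_iterate_derivative_real (splits_prod_X_add_C s l) _) (fun m => ?_) ?_
    (j := k - j) (by omega)
  · rw [hcoeff (by omega), show k - (k - j) = j by omega] at hp
    exact pos_of_mul_pos_right hp (hfac _).le
  · rcases le_or_gt m k with hm | hm
    · rw [hcoeff hm]
      exact mul_nonneg (hfac m).le (h _ (by omega))
    · rw [Polynomial.coeff_eq_zero_of_natDegree_lt (by omega)]
  · rw [hcoeff (Nat.zero_le k)]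
    exact mul_pos (hfac 0) (by simpa using hpos)

theorem continuous_elemSymm {n : ℕ} (k : ℕ) : Continuous (elemSymm k : (Fin n → ℝ) → ℝ) := by
  unfold elemSymm
  fun_prop

/-- On `Γ_k` all of `S₀, …, S_k` are positive. -/
theorem elemSymm_pos_of_mem_gammaCone {n k : ℕ} (hkn : k ≤ n) {l : Fin n → ℝ}
    (hl : l ∈ gammaCone n k) : ∀ j ≤ k, 0 < elemSymm j l := by
  set G : Set (Fin n → ℝ) := {l | ∀ j ≤ k, 0 < elemSymm j l} with hG
  have hGo : IsOpen G := by
    have : G = ⋂ j ∈ Finset.range (k + 1), {l | 0 < elemSymm j l} := by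
      ext l
      simp [hG]
    rw [this]
    exact isOpen_biInter_finset fun j _ => isOpen_lt continuous_const (continuous_elemSymm j)
  have hone : (fun _ => 1 : Fin n → ℝ) ∈ G := by
    intro j hj
    simp [elemSymm]
    exact Nat.choose_pos (hj.trans hkn)
  -- `G` is open and also relatively closed in `{S_k > 0}`: at a limit point all `S_j ≥ 0` and `S_k
  -- > 0`, which forces every `S_j > 0`. A connected component meeting `G` therefore stays in it.
  refine isPreconnected_connectedComponentIn.subset_of_closure_inter_subset hGo
    ⟨_, mem_connectedComponentIn (hone k le_rfl), hone⟩ ?_ hl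
  rintro m ⟨hmc, hm⟩
  have hm0 : 0 < elemSymm k m :=
    connectedComponentIn_subset {l : Fin n → ℝ | 0 < elemSymm k l} _ hm
  refine esymOn_pos_of_nonneg (by simpa using hkn) (fun j hj => ?_) hm0
  have hcl : IsClosed {l : Fin n → ℝ | 0 ≤ elemSymm j l} :=
    isClosed_le continuous_const (continuous_elemSymm j)
  exact closure_minimal (fun l hl => (hl j hj).le) hcl hmc

/-- `S_j` is affine in each variable, with slope `S_{j-1}` of the remaining variables, which is
positive by the deletion lemma `esymOn_pos_of_insert`. -/
theorem elemSymm_update_le {n k : ℕ} {l : Fin n → ℝ} (hl : ∀ j ≤ k, 0 < elemSymm j l)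
    (i : Fin n) {a : ℝ} (ha : l i ≤ a) :
    ∀ j ≤ k, elemSymm j l ≤ elemSymm j (Function.update l i a) := by
  intro j hj
  cases j with
  | zero => simp [elemSymm]
  | succ j =>
    have hi : i ∉ Finset.univ.erase i := Finset.notMem_erase i _
    have hins : insert i (Finset.univ.erase i) = Finset.univ :=
      Finset.insert_erase (Finset.mem_univ i)
    have hpos := esymOn_pos_of_insert hi (l := l) (k := k) (by rw [hins]; exact hl) j (by omega)
    change esymOn _ _ _ ≤ esymOn _ _ _
    rw [← hins, esymOn_insert hi, esymOn_insert hi]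
    have hc := esymOn_congr (s := Finset.univ.erase i) (l := Function.update l i a) (m := l)
      fun b hb => Function.update_of_ne (Finset.ne_of_mem_erase hb) _ _
    rw [hc, hc, Function.update_self]
    gcongr

/-- `S_j`, `j ≤ k`, is monotone in each variable where `S₀, …, S_k` are positive. -/
theorem elemSymm_mono_of_pos {n k : ℕ} {l m : Fin n → ℝ} (hl : ∀ j ≤ k, 0 < elemSymm j l)
    (hlm : l ≤ m) : elemSymm k l ≤ elemSymm k m := by
  -- Coordinates are raised one at a time. All `j ≤ k` are carried together, because the next raise
  -- needs every `S_j` still positive.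
  have key : ∀ T : Finset (Fin n), ∀ j ≤ k, elemSymm j l ≤ elemSymm j (T.piecewise m l) := by
    intro T
    induction T using Finset.induction with
    | empty => simp
    | insert i T hi ih =>
      intro j hj
      rw [Finset.piecewise_insert]
      refine (ih j hj).trans (elemSymm_update_le (k := k)
        (fun b hb => (hl b hb).trans_le (ih b hb)) i ?_ j hj)
      rw [Finset.piecewise_eq_of_notMem _ _ _ hi]
      exact hlm i
  simpa using key Finset.univ k le_rfl

theorem elemSymm_smul {n : ℕ} (k : ℕ) (c : ℝ) (l : Fin n → ℝ) :
    elemSymm k (c • l) = c ^ k * elemSymm k l := by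
  unfold elemSymm
  rw [Finset.mul_sum]
  refine Finset.sum_congr rfl fun t ht => ?_
  simp [Finset.prod_mul_distrib, (Finset.mem_powersetCard.1 ht).2]

/-- `S_k` is monotone on the closure of `Γ_k`. -/
theorem elemSymm_mono_of_mem_closure {n k : ℕ} (hkn : k ≤ n) {l m : Fin n → ℝ}
    (hl : l ∈ closure (gammaCone n k)) (hlm : l ≤ m) : elemSymm k l ≤ elemSymm k m := by
  have hcl : IsClosed {a : Fin n → ℝ | elemSymm k a ≤ elemSymm k (a + (m - l))} :=
    isClosed_le (continuous_elemSymm k) ((continuous_elemSymm k).comp (by fun_prop))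
  have := closure_minimal (fun a ha => ?_) hcl hl
  · simpa using this
  · exact elemSymm_mono_of_pos (elemSymm_pos_of_mem_gammaCone hkn ha)
      (le_add_of_nonneg_right (sub_nonneg.2 hlm))

/-! ### Monotonicity of `S_k` on symmetric matrices. -/

/-- Weyl's monotonicity principle for symmetric operators. -/
theorem eigenvalues_le_of_inner_le {E : Type*} [NormedAddCommGroup E] [InnerProductSpace ℝ E]
    [FiniteDimensional ℝ E] {N : ℕ} {T S : E →ₗ[ℝ] E} (hT : T.IsSymmetric) (hS : S.IsSymmetric)
    (hN : Module.finrank ℝ E = N) {r : ℝ} (hr : 0 ≤ r)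
    (h : ∀ x, r * inner ℝ (T x) x ≤ inner ℝ (S x) x) (i : Fin N) :
    r * hT.eigenvalues hN i ≤ hS.eigenvalues hN i := by
  set b := hT.eigenvectorBasis hN
  set c := hS.eigenvectorBasis hN
  have hexp {R : E →ₗ[ℝ] E} (hR : R.IsSymmetric) (x : E) :
      inner ℝ (R x) x
        = ∑ j, hR.eigenvalues hN j * inner ℝ (hR.eigenvectorBasis hN j) x ^ 2 := by
    rw [← (hR.eigenvectorBasis hN).sum_inner_mul_inner]
    refine Finset.sum_congr rfl fun j _ => ?_
    rw [hR, hR.apply_eigenvectorBasis, inner_smul_right, real_inner_comm]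
    simp
    ring
  have hnorm (e : OrthonormalBasis (Fin N) ℝ E) (x : E) :
      ‖x‖ ^ 2 = ∑ j, inner ℝ (e j) x ^ 2 := by
    rw [← real_inner_self_eq_norm_sq, ← e.sum_inner_mul_inner]
    refine Finset.sum_congr rfl fun j _ => ?_
    rw [real_inner_comm, sq]
  obtain ⟨x, hx0, hxb, hxc⟩ : ∃ x : E, x ≠ 0 ∧ (∀ j, i < j → inner ℝ (b j) x = 0) ∧
      ∀ j, j < i → inner ℝ (c j) x = 0 := by
    -- These are only `N - 1` conditions: the `i`-th component of `f` is zero, so `f` is not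
    -- surjective and has a nontrivial kernel.
    let f : E →ₗ[ℝ] (Fin N → ℝ) := LinearMap.pi fun j =>
      if i < j then (innerSL ℝ (b j)).toLinearMap
      else if j < i then (innerSL ℝ (c j)).toLinearMap else 0
    have hf : ¬ Function.Injective f := by
      rw [LinearMap.injective_iff_surjective_of_finrank_eq_finrank (by simp [hN])]
      intro hsurj
      obtain ⟨x, hx⟩ := hsurj (Pi.single i 1)
      have := congrFun hx i
      simp [f] at this
    rw [injective_iff_map_eq_zero] at hf
    push Not at hf
    obtain ⟨x, hx, hx0⟩ := hf
    refine ⟨x, hx0, fun j hj => ?_, fun j hj => ?_⟩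
    · simpa [f, hj] using congrFun hx j
    · simpa [f, hj, hj.not_gt] using congrFun hx j
  have h1 : hT.eigenvalues hN i * ‖x‖ ^ 2 ≤ inner ℝ (T x) x := by
    rw [hexp hT, hnorm b, Finset.mul_sum]
    refine Finset.sum_le_sum fun j _ => ?_
    rcases lt_or_ge i j with hj | hj
    · have : inner ℝ (b j) x = 0 := hxb j hj
      rw [this]
      simp
    · exact mul_le_mul_of_nonneg_right (hT.eigenvalues_antitone hN hj) (sq_nonneg _)
  have h2 : inner ℝ (S x) x ≤ hS.eigenvalues hN i * ‖x‖ ^ 2 := by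
    rw [hexp hS, hnorm c, Finset.mul_sum]
    refine Finset.sum_le_sum fun j _ => ?_
    rcases lt_or_ge j i with hj | hj
    · have : inner ℝ (c j) x = 0 := hxc j hj
      rw [this]
      simp
    · exact mul_le_mul_of_nonneg_right (hS.eigenvalues_antitone hN hj) (sq_nonneg _)
  have hx : 0 < ‖x‖ ^ 2 := by positivity
  refine le_of_mul_le_mul_right ?_ hx
  calc r * hT.eigenvalues hN i * ‖x‖ ^ 2 = r * (hT.eigenvalues hN i * ‖x‖ ^ 2) := by ring
    _ ≤ r * inner ℝ (T x) x := mul_le_mul_of_nonneg_left h1 hr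
    _ ≤ _ := (h x).trans h2

/-- Monotonicity of `S_k` on symmetric matrices, with a scaling factor. -/
theorem pow_mul_matSymm_le {n k : ℕ} (hkn : k ≤ n) {A B : Matrix (Fin n) (Fin n) ℝ}
    (hA : A.IsHermitian) (hB : B.IsHermitian) {r : ℝ} (hr : 0 < r)
    (h : ∀ x : Euc n, r * inner ℝ (Matrix.toEuclideanLin A x) x
      ≤ inner ℝ (Matrix.toEuclideanLin B x) x)
    (hcone : eigenvaluesOf A ∈ closure (gammaCone n k)) :
    r ^ k * matSymm k A ≤ matSymm k B := by
  classical
  -- The scaling is moved to `B`, so that the cone condition on `A` applies as it stands;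
  -- homogeneity of `S_k` restores the factor.
  have hle : eigenvaluesOf A ≤ r⁻¹ • eigenvaluesOf B := by
    intro i
    rw [Pi.smul_apply, smul_eq_mul, le_inv_mul_iff₀ hr, eigenvaluesOf, dif_pos hA, eigenvaluesOf,
      dif_pos hB]
    unfold Matrix.IsHermitian.eigenvalues Matrix.IsHermitian.eigenvalues₀
    exact eigenvalues_le_of_inner_le _ _ _ hr.le h _
  have := elemSymm_mono_of_mem_closure hkn hcone hle
  rwa [elemSymm_smul, inv_pow, le_inv_mul_iff₀ (by positivity)] at this

/-- The quadratic form of the Hessian matrix is the second derivative. -/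
theorem inner_hessianMat {n : ℕ} (u : Euc n → ℝ) (x ξ : Euc n) :
    inner ℝ (Matrix.toEuclideanLin (hessianMat u x) ξ) ξ = fderiv ℝ (fderiv ℝ u) x ξ ξ := by
  have hξ : ξ = ∑ i, ξ i • EuclideanSpace.single i (1 : ℝ) := by
    ext j
    simp [Finset.sum_apply, Pi.single_apply]
  have hR : fderiv ℝ (fderiv ℝ u) x ξ ξ = ∑ i, ∑ j, ξ i * (ξ j * hessianMat u x i j) := by
    conv_lhs => rw [hξ]
    simp only [map_sum, map_smul, sum_apply, smul_apply,
      smul_eq_mul, Finset.mul_sum, hessianMat, Matrix.of_apply]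
    rw [Finset.sum_comm]
    refine Finset.sum_congr rfl fun i _ => Finset.sum_congr rfl fun j _ => ?_
    ring
  rw [hR]
  simp only [PiLp.inner_apply, RCLike.inner_apply, conj_trivial]
  refine Finset.sum_congr rfl fun i _ => ?_
  simp [Matrix.toLpLin_apply, Matrix.mulVec, dotProduct, Finset.mul_sum, mul_comm, mul_left_comm]

/-! ### Conditions at an interior maximum, and its existence. -/

/-- Second-order necessary condition for a local maximum in one variable. -/
theorem IsLocalMax.second_deriv_nonpos {g : ℝ → ℝ} {a : ℝ} (h : IsLocalMax g a)
    (hc : ContinuousAt g a) : deriv (deriv g) a ≤ 0 := by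
  by_contra! hpos
  -- A point that is both a local maximum and a local minimum has `g` constant nearby.
  have hmin := isLocalMin_of_deriv_deriv_pos hpos h.deriv_eq_zero hc
  have heq : g =ᶠ[nhds a] fun _ => g a := by
    filter_upwards [h, hmin] with x h1 h2 using le_antisymm h1 h2
  have h2 : deriv (deriv g) a = 0 := by
    rw [heq.deriv.deriv_eq]
    simp
  exact hpos.ne' h2

/-- Differentiation of `s ↦ u (z + s ξ)` for a `C²` function. -/
theorem hasDerivAt_line {E : Type*} [NormedAddCommGroup E] [NormedSpace ℝ E] {u : E → ℝ}
    {z ξ : E} (hu : ContDiffAt ℝ 2 u z) :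
    (∀ᶠ s in nhds (0 : ℝ), HasDerivAt (fun s : ℝ => u (z + s • ξ))
      (fderiv ℝ u (z + s • ξ) ξ) s) ∧
    HasDerivAt (fun s : ℝ => fderiv ℝ u (z + s • ξ) ξ) (fderiv ℝ (fderiv ℝ u) z ξ ξ) 0 := by
  have hline (s : ℝ) : HasDerivAt (fun s : ℝ => z + s • ξ) ξ s := by
    simpa using ((hasDerivAt_id s).smul_const ξ).const_add z
  have hcont : Filter.Tendsto (fun s : ℝ => z + s • ξ) (nhds 0) (nhds z) := by
    have := (hline 0).continuousAt
    simpa [ContinuousAt] using this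
  constructor
  · filter_upwards [hcont.eventually (hu.eventually (by simp))] with s hs
    exact (hs.differentiableAt (by norm_num)).hasFDerivAt.comp_hasDerivAt s (hline s)
  · have hd : DifferentiableAt ℝ (fderiv ℝ u) z :=
      (hu.fderiv_right (m := 1) (by norm_num)).differentiableAt (by norm_num)
    have h1 : HasDerivAt (fun s : ℝ => fderiv ℝ u (z + s • ξ)) (fderiv ℝ (fderiv ℝ u) z ξ) 0 := by
      refine HasFDerivAt.comp_hasDerivAt (f := fun s : ℝ => z + s • ξ) 0 ?_ (hline 0)
      simpa using hd.hasFDerivAt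
    simpa using h1.clm_apply (hasDerivAt_const 0 ξ)

/-- First- and second-order conditions at a local maximum of `x ↦ c u(x₀ + t (x - x₀)) - v x`. -/
theorem IsLocalMax.dilation_conditions {E : Type*} [NormedAddCommGroup E] [NormedSpace ℝ E]
    {u v : E → ℝ} {x₀ y : E} {c t : ℝ} (hu : ContDiffAt ℝ 2 u (x₀ + t • (y - x₀)))
    (hv : ContDiffAt ℝ 2 v y)
    (hmax : IsLocalMax (fun x => c * u (x₀ + t • (x - x₀)) - v x) y) :
    fderiv ℝ v y = (c * t) • fderiv ℝ u (x₀ + t • (y - x₀)) ∧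
    ∀ ξ, c * t ^ 2 * fderiv ℝ (fderiv ℝ u) (x₀ + t • (y - x₀)) ξ ξ
      ≤ fderiv ℝ (fderiv ℝ v) y ξ ξ := by
  set z := x₀ + t • (y - x₀) with hz
  have hline (ξ : E) : Filter.Tendsto (fun s : ℝ => y + s • ξ) (nhds 0) (nhds y) := by
    have : Continuous fun s : ℝ => y + s • ξ := by fun_prop
    simpa using this.tendsto 0
  have hg (ξ : E) : IsLocalMax (fun s : ℝ => c * u (z + s • (t • ξ)) - v (y + s • ξ)) 0 := by
    filter_upwards [(hline ξ).eventually hmax] with s hs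
    have e : x₀ + t • (y + s • ξ - x₀) = z + s • (t • ξ) := by
      rw [hz]
      module
    simpa [e, ← hz] using hs
  have hd (ξ : E) : (∀ᶠ s in nhds (0 : ℝ),
      HasDerivAt (fun s : ℝ => c * u (z + s • (t • ξ)) - v (y + s • ξ))
        (c * fderiv ℝ u (z + s • (t • ξ)) (t • ξ) - fderiv ℝ v (y + s • ξ) ξ) s) := by
    filter_upwards [(hasDerivAt_line (ξ := t • ξ) hu).1, (hasDerivAt_line (ξ := ξ) hv).1]
      with s h1 h2 using (h1.const_mul c).sub h2
  constructor
  · ext ξ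
    have := (hg ξ).hasDerivAt_eq_zero (hd ξ).self_of_nhds
    simp at this ⊢
    linarith
  · intro ξ
    have h2 := (hg ξ).second_deriv_nonpos (hd ξ).self_of_nhds.continuousAt
    have he : deriv (fun s : ℝ => c * u (z + s • (t • ξ)) - v (y + s • ξ)) =ᶠ[nhds 0]
        fun s => c * fderiv ℝ u (z + s • (t • ξ)) (t • ξ) - fderiv ℝ v (y + s • ξ) ξ := by
      filter_upwards [hd ξ] with s hs using hs.deriv
    have hd2 := ((hasDerivAt_line (ξ := t • ξ) hu).2.const_mul c).sub
      (hasDerivAt_line (ξ := ξ) hv).2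
    rw [he.deriv_eq, show deriv (fun s : ℝ => c * fderiv ℝ u (z + s • (t • ξ)) (t • ξ)
      - fderiv ℝ v (y + s • ξ) ξ) 0 = _ from hd2.deriv] at h2
    simp at h2
    linarith

theorem gradient_eq_smul_of_fderiv_eq {n : ℕ} {u v : Euc n → ℝ} {x y : Euc n} {c : ℝ}
    (h : fderiv ℝ v y = c • fderiv ℝ u x) : gradient v y = c • gradient u x := by
  simp [gradient, h]

/-- A function continuous on the closure of a bounded open set minus one that blows up at the
boundary attains its maximum over the set, as soon as it is positive somewhere. -/
theorem BlowsUpAtBoundary.exists_isMaxOn {n : ℕ} {Ω : Set (Euc n)} (hΩo : IsOpen Ω)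
    (hΩb : Bornology.IsBounded Ω) {f v : Euc n → ℝ} (hf : ContinuousOn f (closure Ω))
    (hv : ContinuousOn v Ω) (hblow : BlowsUpAtBoundary Ω v) {x : Euc n} (hx : x ∈ Ω)
    (hpos : 0 < f x - v x) :
    ∃ y ∈ Ω, 0 < f y - v y ∧ IsMaxOn (fun w => f w - v w) Ω y := by
  have hcomp : IsCompact (closure Ω) := hΩb.isCompact_closure
  obtain ⟨M, hM⟩ := hcomp.bddAbove_image hf
  have hM' : ∀ w ∈ closure Ω, f w ≤ M := fun w hw => hM (Set.mem_image_of_mem f hw)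
  obtain ⟨δ, hδ, hvδ⟩ := hblow M
  -- Off `K` the difference `f - v` is negative, so the maximum over the compact set `K` is global.
  set K := closure Ω ∩ {w | δ ≤ Metric.infDist w (frontier Ω)} with hK
  have hKc : IsCompact K :=
    hcomp.inter_right (isClosed_le continuous_const (Metric.continuous_infDist_pt _))
  have hKΩ : K ⊆ Ω := by
    rintro w ⟨hw, hwδ⟩
    by_contra hwn
    have hwf : w ∈ frontier Ω := ⟨hw, by rwa [hΩo.interior_eq]⟩
    have := Metric.infDist_zero_of_mem hwf
    simp only [Set.mem_ofPred_eq, this] at hwδ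
    linarith
  have hout : ∀ w ∈ Ω, w ∉ K → f w - v w < 0 := by
    intro w hw hwK
    have hlt : Metric.infDist w (frontier Ω) < δ := by
      by_contra! hge
      exact hwK ⟨subset_closure hw, hge⟩
    linarith [hvδ w hw hlt, hM' w (subset_closure hw)]
  have hxK : x ∈ K := by
    by_contra hxK
    linarith [hout x hx hxK]
  obtain ⟨y, hyK, hy⟩ := hKc.exists_isMaxOn ⟨x, hxK⟩
    ((hf.mono Set.inter_subset_left).sub (hv.mono hKΩ))
  have hyx : f x - v x ≤ f y - v y := hy hxK
  refine ⟨y, hKΩ hyK, hpos.trans_le hyx, fun w hw => ?_⟩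
  by_cases hwK : w ∈ K
  · exact hy hwK
  · have := hout w hw hwK
    simp only [Set.mem_ofPred_eq]
    linarith

/-! ### The structure conditions integrated along rays and in `z`. -/

section Structure

variable {n : ℕ} {Ω : Set (Euc n)} {ψ : Euc n → ℝ → Euc n → ℝ}

theorem IsC1On.differentiableAt (hΩo : IsOpen Ω) (hψ : IsC1On Ω ψ) {x : Euc n} (hx : x ∈ Ω)
    (z : ℝ) (p : Euc n) :
    DifferentiableAt ℝ (fun w : Euc n × ℝ × Euc n => ψ w.1 w.2.1 w.2.2) (x, z, p) :=
  (hψ.contDiffAt ((hΩo.prod isOpen_univ).mem_nhds ⟨hx, Set.mem_univ _⟩)).differentiableAt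
    (by norm_num)

/-- If `(x - x₀) · D_x ψ ≤ 0`, then `ψ` decreases along rays from `x₀`. -/
theorem le_dilation_of_inner_gradient_nonpos (hΩo : IsOpen Ω) {x₀ : Euc n}
    (hstar : StarShapedAt Ω x₀) (hψ : IsC1On Ω ψ)
    (hψx : ∀ x ∈ Ω, ∀ (z : ℝ) (p : Euc n),
      inner ℝ (x - x₀) (gradient (fun y => ψ y z p) x) ≤ 0)
    {x : Euc n} (hx : x ∈ Ω) {t : ℝ} (ht0 : 0 < t) (ht1 : t ≤ 1) (z : ℝ) (p : Euc n) :
    ψ x z p ≤ ψ (x₀ + t • (x - x₀)) z p := by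
  have hmem : ∀ s ∈ Set.Icc t 1, x₀ + s • (x - x₀) ∈ Ω := by
    intro s hs
    rcases hs.2.lt_or_eq with h | h
    · exact hstar x (subset_closure hx) s (ht0.le.trans hs.1) h
    · simpa [h] using hx
  have hder : ∀ s ∈ Set.Icc t 1, HasDerivAt (fun s : ℝ => ψ (x₀ + s • (x - x₀)) z p)
      (inner ℝ (gradient (fun y => ψ y z p) (x₀ + s • (x - x₀))) (x - x₀)) s := by
    intro s hs
    have hd : DifferentiableAt ℝ (fun y => ψ y z p) (x₀ + s • (x - x₀)) :=
      (hψ.differentiableAt hΩo (hmem s hs) z p).comp (x₀ + s • (x - x₀))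
        (f := fun y => (y, z, p)) (by fun_prop)
    have hline : HasDerivAt (fun s : ℝ => x₀ + s • (x - x₀)) (x - x₀) s := by
      simpa using ((hasDerivAt_id s).smul_const (x - x₀)).const_add x₀
    have hcomp := hd.hasFDerivAt.comp_hasDerivAt s hline
    have hin := InnerProductSpace.toDual_symm_apply (𝕜 := ℝ) (x := x - x₀)
      (y := fderiv ℝ (fun y => ψ y z p) (x₀ + s • (x - x₀)))
    rw [gradient, hin]
    exact hcomp
  have hanti : AntitoneOn (fun s : ℝ => ψ (x₀ + s • (x - x₀)) z p) (Set.Icc t 1) := by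
    refine antitoneOn_of_deriv_nonpos (convex_Icc t 1)
      (fun s hs => (hder s hs).continuousAt.continuousWithinAt) (fun s hs => ?_) fun s hs => ?_
    · exact (hder s (interior_subset hs)).differentiableAt.differentiableWithinAt
    · have hs' := interior_subset hs
      rw [(hder s hs').deriv, real_inner_comm]
      have := hψx _ (hmem s hs') z p
      -- The hypothesis at `x₀ + s(x - x₀)` is `s` times the derivative along the ray, and `s > 0`.
      rw [add_sub_cancel_left, inner_smul_left] at this
      exact nonpos_of_mul_nonpos_right this (ht0.trans_le hs'.1)
  simpa using hanti ⟨le_rfl, ht1⟩ ⟨ht1, le_rfl⟩ ht1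

/-- If `p · D_p ψ ≥ 0`, then `ψ` increases along rays in the gradient variable. -/
theorem smul_le_of_inner_gradient_nonneg (hΩo : IsOpen Ω) (hψ : IsC1On Ω ψ)
    (hψp : ∀ x ∈ Ω, ∀ (z : ℝ) (p : Euc n), 0 ≤ inner ℝ p (gradient (fun r => ψ x z r) p))
    {x : Euc n} (hx : x ∈ Ω) {t : ℝ} (ht0 : 0 < t) (ht1 : t ≤ 1) (z : ℝ) (p : Euc n) :
    ψ x z (t • p) ≤ ψ x z p := by
  have hder (s : ℝ) : HasDerivAt (fun s : ℝ => ψ x z (s • p))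
      (inner ℝ (gradient (fun r => ψ x z r) (s • p)) p) s := by
    have hd : DifferentiableAt ℝ (fun r => ψ x z r) (s • p) :=
      (hψ.differentiableAt hΩo hx z (s • p)).comp (s • p)
        (f := fun r => (x, z, r)) (by fun_prop)
    have hline : HasDerivAt (fun s : ℝ => s • p) p s := by
      simpa using (hasDerivAt_id s).smul_const p
    have hcomp := hd.hasFDerivAt.comp_hasDerivAt s hline
    have hin := InnerProductSpace.toDual_symm_apply (𝕜 := ℝ) (x := p)
      (y := fderiv ℝ (fun r => ψ x z r) (s • p))
    rw [gradient, hin]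
    exact hcomp
  have hmono : MonotoneOn (fun s : ℝ => ψ x z (s • p)) (Set.Icc t 1) := by
    refine monotoneOn_of_deriv_nonneg (convex_Icc t 1)
      (fun s hs => (hder s).continuousAt.continuousWithinAt)
      (fun s hs => (hder s).differentiableAt.differentiableWithinAt) fun s hs => ?_
    have hs' := interior_subset hs
    rw [(hder s).deriv, real_inner_comm]
    have := hψp x hx z (s • p)
    rw [inner_smul_left] at this
    exact nonneg_of_mul_nonneg_right this (ht0.trans_le hs'.1)
  simpa using hmono ⟨le_rfl, ht1⟩ ⟨ht1, le_rfl⟩ ht1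

/-- If `ψ_z ≥ ε ψ`, then `ψ` grows at least exponentially in `z`. -/
theorem exp_mul_le_of_mul_le_deriv (hΩo : IsOpen Ω) (hψ : IsC1On Ω ψ) {ε : ℝ}
    {x : Euc n} (hx : x ∈ Ω) {p : Euc n}
    (hψz : ∀ z : ℝ, ε * ψ x z p ≤ deriv (fun s => ψ x s p) z) {z z' : ℝ} (hz : z' ≤ z) :
    Real.exp (ε * (z - z')) * ψ x z' p ≤ ψ x z p := by
  have hd (s : ℝ) : DifferentiableAt ℝ (fun s => ψ x s p) s :=
    (hψ.differentiableAt hΩo hx s p).comp s (f := fun r => (x, r, p)) (by fun_prop)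
  have he (s : ℝ) : HasDerivAt (fun s : ℝ => Real.exp (-(ε * s))) (Real.exp (-(ε * s)) * -ε) s := by
    have h1 : HasDerivAt (fun s : ℝ => -(ε * s)) (-ε) s := by
      simpa using ((hasDerivAt_id' s).const_mul ε).fun_neg
    exact h1.exp
  have hder (s : ℝ) := (he s).mul (hd s).hasDerivAt
  -- `e^{-εs}` is an integrating factor for `ψ_z ≥ ε ψ`.
  have hmono : Monotone fun s : ℝ => Real.exp (-(ε * s)) * ψ x s p := by
    refine monotone_of_deriv_nonneg (fun s => (hder s).differentiableAt) fun s => ?_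
    have : deriv (fun s : ℝ => Real.exp (-(ε * s)) * ψ x s p) s = _ := (hder s).deriv
    rw [this]
    have := mul_le_mul_of_nonneg_left (hψz s) (Real.exp_pos (-(ε * s))).le
    linarith
  have := mul_le_mul_of_nonneg_left (hmono hz) (Real.exp_pos (ε * z)).le
  simp only [← mul_assoc, ← Real.exp_add] at this
  simpa [mul_add, sub_eq_add_neg] using this

end Structure

/-! ### The dilation argument. -/

/-- Comparison by dilation: `u ≤ v` as soon as the structure function grows in `z` enough to
absorb the factor produced by `x ↦ c(t) u(x₀ + t (x - x₀)) - d(t)` as `t → 1⁻`. -/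
theorem le_of_dilation_growth {n k : ℕ} (hkn : k ≤ n) {Ω : Set (Euc n)} (hΩo : IsOpen Ω)
    (hΩb : Bornology.IsBounded Ω) {x₀ : Euc n} (hstar : StarShapedAt Ω x₀)
    {ψ φ : Euc n → ℝ → Euc n → ℝ} (hψ : IsC1On Ω ψ)
    (hψx : ∀ x ∈ Ω, ∀ (z : ℝ) (p : Euc n),
      inner ℝ (x - x₀) (gradient (fun y => ψ y z p) x) ≤ 0)
    (hψp : ∀ x ∈ Ω, ∀ (z : ℝ) (p : Euc n), 0 ≤ inner ℝ p (gradient (fun r => ψ x z r) p))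
    {c d : ℝ → ℝ} (hc : Filter.Tendsto c (nhdsWithin 1 (Set.Iio 1)) (nhds 1))
    (hd : Filter.Tendsto d (nhdsWithin 1 (Set.Iio 1)) (nhds 0))
    (hcpos : ∀ t ∈ Set.Ioo (0 : ℝ) 1, 0 < c t ∧ c t ≤ 1)
    (hgrow : ∀ t ∈ Set.Ioo (0 : ℝ) 1, ∀ x ∈ Ω, ∀ (z z' : ℝ) (p : Euc n), 0 < ψ x z' p →
      z' < c t * z - d t → ψ x z' p < (c t * t ^ 2) ^ k * ψ x z p)
    (hφψ : ∀ x ∈ Ω, ∀ (z : ℝ) (p : Euc n), φ x z p ≤ ψ x z p)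
    {u v : Euc n → ℝ} (hu : KConvexOn k Ω u) (hv : StrictKConvexOn k Ω v)
    (hblow : BlowsUpAtBoundary Ω v) (hsub : IsSubsolution k Ω ψ u)
    (hsup : IsSupersolution k Ω φ v) {x : Euc n} (hx : x ∈ Ω) : u x ≤ v x := by
  by_contra! hlt
  obtain ⟨t, ht, hxt⟩ : ∃ t ∈ Set.Ioo (0 : ℝ) 1,
      v x < c t * u (x₀ + t • (x - x₀)) - d t := by
    have hline : Filter.Tendsto (fun t : ℝ => x₀ + t • (x - x₀)) (nhdsWithin 1 (Set.Iio 1))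
        (nhds x) := by
      have : Continuous fun t : ℝ => x₀ + t • (x - x₀) := by fun_prop
      have h := this.tendsto 1
      simp only [one_smul, add_sub_cancel] at h
      exact h.mono_left nhdsWithin_le_nhds
    have hux : Filter.Tendsto u (nhds x) (nhds (u x)) :=
      (hu.1.continuousOn.continuousAt (hΩo.mem_nhds hx))
    have hlim := (hc.mul (hux.comp hline)).sub hd
    rw [one_mul, sub_zero] at hlim
    have h01 : Set.Ioo (0 : ℝ) 1 ∈ nhdsWithin (1 : ℝ) (Set.Iio 1) :=
      Ioo_mem_nhdsLT (by norm_num)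
    obtain ⟨t, h1, h2⟩ := ((hlim.eventually (lt_mem_nhds hlt)).and h01).exists
    exact ⟨t, h2, h1⟩
  obtain ⟨hc0, hc1⟩ := hcpos t ht
  have hmaps : Set.MapsTo (fun w : Euc n => x₀ + t • (w - x₀)) (closure Ω) Ω :=
    fun w hw => hstar w hw t ht.1.le ht.2
  have hf : ContinuousOn (fun w => c t * u (x₀ + t • (w - x₀)) - d t) (closure Ω) :=
    (continuousOn_const.mul (hu.1.continuousOn.comp (by fun_prop) hmaps)).sub continuousOn_const
  obtain ⟨y, hy, hypos, hmax⟩ := hblow.exists_isMaxOn hΩo hΩb hf hv.1.continuousOn hx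
    (sub_pos.2 hxt)
  set z := x₀ + t • (y - x₀) with hz
  have hzΩ : z ∈ Ω := hmaps (subset_closure hy)
  have hloc : IsLocalMax (fun w => c t * u (x₀ + t • (w - x₀)) - v w) y := by
    filter_upwards [hΩo.mem_nhds hy] with w hw
    have : c t * u (x₀ + t • (w - x₀)) - d t - v w
      ≤ c t * u (x₀ + t • (y - x₀)) - d t - v y := hmax hw
    linarith
  obtain ⟨hgrad, hhess⟩ := hloc.dilation_conditions
    (hu.1.contDiffAt (hΩo.mem_nhds hzΩ)) (hv.1.contDiffAt (hΩo.mem_nhds hy))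
  rw [← hz] at hgrad hhess
  have hS : (c t * t ^ 2) ^ k * matSymm k (hessianMat u z) ≤ matSymm k (hessianMat v y) := by
    refine pow_mul_matSymm_le hkn (hessianMat_isHermitian hΩo hu.1 hzΩ)
      (hessianMat_isHermitian hΩo hv.1 hy) (mul_pos hc0 (pow_pos ht.1 2)) (fun ξ => ?_)
      (hu.2 z hzΩ)
    rw [inner_hessianMat, inner_hessianMat]
    exact hhess ξ
  have hSv : 0 < matSymm k (hessianMat v y) :=
    elemSymm_pos_of_mem_gammaCone hkn (hv.2 y hy) k le_rfl
  have hle : matSymm k (hessianMat v y) ≤ ψ y (v y) (gradient v y) :=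
    (hsup y hy).trans (hφψ y hy _ _)
  -- Strict `k`-convexity of `v` supplies the positivity of `ψ` required by the growth condition.
  have hlt' := hgrow t ht y hy (u z) (v y) (gradient v y) (hSv.trans_le hle) (sub_pos.1 hypos)
  have hψu : ψ y (u z) (gradient v y) ≤ matSymm k (hessianMat u z) := by
    rw [gradient_eq_smul_of_fderiv_eq hgrad]
    exact (smul_le_of_inner_gradient_nonneg hΩo hψ hψp hy (mul_pos hc0 ht.1)
      (mul_le_one₀ hc1 ht.1.le ht.2.le) _ _).trans
      ((le_dilation_of_inner_gradient_nonpos hΩo hstar hψ hψx hy ht.1 ht.2.le _ _).trans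
        (hsub z hzΩ))
  have hcont := mul_le_mul_of_nonneg_left hψu
    (pow_nonneg (mul_nonneg hc0.le (sq_nonneg t)) k)
  linarith

/-! ### The two growth conditions. -/

/-- The power-growth condition forces `z > 0` wherever `ψ(x, z, p) > 0`. -/
theorem pos_of_power_growth {q : ℝ} (hq : 0 < q) {g : ℝ → ℝ}
    (hg : ∀ μ : ℝ, 1 ≤ μ → ∀ z : ℝ, μ ^ q * g z ≤ g (μ * max z 0)) {z : ℝ} (hz : 0 < g z) :
    0 < z := by
  by_contra! hz0
  -- For `z ≤ 0` the condition would bound `μ^q g(z)` by `g(0)` for every `μ ≥ 1`.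
  have hlim := (tendsto_rpow_atTop hq).atTop_mul_const hz
  obtain ⟨μ, h1, h2⟩ := ((hlim.eventually_gt_atTop (g 0)).and
    (Filter.eventually_ge_atTop 1)).exists
  have := hg μ h2 z
  rw [max_eq_right hz0, mul_zero] at this
  linarith

/-- The power-growth condition absorbs the factor `(t ^ β t²)ᵏ`, `β = (2k + 1) / (q - k)`. -/
theorem lt_of_power_growth {k : ℕ} {q : ℝ} (hq : (k : ℝ) < q) {g : ℝ → ℝ}
    (hg : ∀ μ : ℝ, 1 ≤ μ → ∀ z : ℝ, μ ^ q * g z ≤ g (μ * max z 0)) {t z z' : ℝ}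
    (ht : t ∈ Set.Ioo (0 : ℝ) 1) (hpos : 0 < g z')
    (hz : z' < t ^ ((2 * k + 1) / (q - k)) * z) :
    g z' < (t ^ ((2 * k + 1) / (q - k)) * t ^ 2) ^ k * g z := by
  have hqk : 0 < q - k := sub_pos.2 hq
  have hk0 : (0 : ℝ) ≤ k := k.cast_nonneg
  have hq0 : 0 < q := by linarith
  have hz' := pos_of_power_growth hq0 hg hpos
  set β : ℝ := (2 * k + 1) / (q - k) with hβ
  have hβ0 : 0 < β := by positivity
  -- Then `k(β + 2) - βq = -1`. The `+ 1` in `β` leaves a factor `t⁻¹ > 1`, which makes the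
  -- conclusion strict.
  have hβq : β * q = β * k + 2 * k + 1 := by
    rw [hβ]
    field_simp
    ring
  have htβ : 0 < t ^ β := Real.rpow_pos_of_pos ht.1 β
  have htβ1 : t ^ β ≤ 1 := Real.rpow_le_one ht.1.le ht.2.le hβ0.le
  have hμ : (t ^ β)⁻¹ ≤ z / z' := by
    rw [inv_eq_one_div, div_le_div_iff₀ htβ hz']
    linarith
  have hμ1 : 1 ≤ z / z' := (one_le_inv₀ htβ |>.2 htβ1).trans hμ
  have h1 := hg _ hμ1 z'
  rw [max_eq_left hz'.le, div_mul_cancel₀ _ hz'.ne'] at h1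
  have h2 : ((t ^ β)⁻¹) ^ q ≤ (z / z') ^ q :=
    Real.rpow_le_rpow (inv_nonneg.2 htβ.le) hμ hq0.le
  have h3 : ((t ^ β)⁻¹) ^ q * g z' ≤ g z := (mul_le_mul_of_nonneg_right h2 hpos.le).trans h1
  have h4 : (t ^ β * t ^ 2) ^ k * ((t ^ β)⁻¹) ^ q = t⁻¹ := by
    rw [← Real.rpow_neg ht.1.le, ← Real.rpow_mul ht.1.le, ← Real.rpow_natCast t 2,
      ← Real.rpow_add ht.1, ← Real.rpow_natCast, ← Real.rpow_mul ht.1.le, ← Real.rpow_add ht.1,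
      ← Real.rpow_neg_one]
    congr 1
    push_cast
    linarith
  have h5 : 1 < t⁻¹ := (one_lt_inv₀ ht.1).2 ht.2
  calc g z' < t⁻¹ * g z' := lt_mul_of_one_lt_left hpos h5
    _ = (t ^ β * t ^ 2) ^ k * (((t ^ β)⁻¹) ^ q * g z') := by rw [← h4]; ring
    _ ≤ _ := mul_le_mul_of_nonneg_left h3 (pow_nonneg (mul_nonneg htβ.le (sq_nonneg t)) k)

theorem tendsto_rpow_const_nhdsLT_one (β : ℝ) :
    Filter.Tendsto (fun t : ℝ => t ^ β) (nhdsWithin 1 (Set.Iio 1)) (nhds 1) := by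
  have h := (Real.continuousAt_rpow_const 1 β (Or.inl one_ne_zero)).tendsto
  rw [Real.one_rpow] at h
  exact h.mono_left nhdsWithin_le_nhds

/-- Exponential growth absorbs the factor `t ^ (2k)`. -/
theorem lt_of_exp_growth {k : ℕ} {ε : ℝ} (hε : 0 < ε) {g : ℝ → ℝ}
    (hg : ∀ z z' : ℝ, z' ≤ z → Real.exp (ε * (z - z')) * g z' ≤ g z) {t z z' : ℝ}
    (ht : t ∈ Set.Ioo (0 : ℝ) 1) (hpos : 0 < g z')
    (hz : z' < z - -(2 * k / ε) * Real.log t) :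
    g z' < (t ^ 2) ^ k * g z := by
  have hlog : Real.log t < 0 := Real.log_neg ht.1 ht.2
  have hk0 : (0 : ℝ) ≤ k := k.cast_nonneg
  have hd : 0 ≤ -(2 * k / ε) * Real.log t :=
    mul_nonneg_of_nonpos_of_nonpos (neg_nonpos.2 (by positivity)) hlog.le
  have h1 := hg z z' (by linarith)
  have htpow : (t ^ 2) ^ k = Real.exp (2 * k * Real.log t) := by
    rw [← pow_mul, ← Real.exp_log (pow_pos ht.1 _), Real.log_pow]
    push_cast
    rfl
  have h2 := mul_le_mul_of_nonneg_left h1 (Real.exp_pos (2 * k * Real.log t)).le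
  rw [htpow]
  refine lt_of_lt_of_le ?_ h2
  rw [← mul_assoc, ← Real.exp_add]
  refine lt_mul_of_one_lt_left hpos (Real.one_lt_exp_iff.2 ?_)
  -- Here `d(t) = -(2k/ε) log t` satisfies `e^{ε d(t)} = t^{-2k}`, and strictness comes from `z' < z
  -- - d(t)`.
  have h3 : 0 < ε * (z - z' - -(2 * k / ε) * Real.log t) := mul_pos hε (by linarith)
  have h4 : ε * (z - z' - -(2 * k / ε) * Real.log t)
      = 2 * k * Real.log t + ε * (z - z') := by
    field_simp
    ring
  linarith

/-! ### Comparison and uniqueness. -/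

theorem theorem2p3 (n k : ℕ) (hk : 1 ≤ k) (hkn : k < n)
    (Ω : Set (Euc n)) (hΩo : IsOpen Ω) (hΩb : Bornology.IsBounded Ω)
    (x₀ : Euc n) (hstar : StarShapedAt Ω x₀)
    (ψ : Euc n → ℝ → Euc n → ℝ) (hψ : IsC1On Ω ψ)
    (hψx : ∀ x ∈ Ω, ∀ (z : ℝ) (p : Euc n),
      inner ℝ (x - x₀) (gradient (fun y => ψ y z p) x) ≤ 0)
    (hψp : ∀ x ∈ Ω, ∀ (z : ℝ) (p : Euc n), 0 ≤ inner ℝ p (gradient (fun r => ψ x z r) p))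
    (hψz :
      (∃ q : ℝ, (k : ℝ) < q ∧ ∀ μ : ℝ, 1 ≤ μ → ∀ x ∈ Ω, ∀ (z : ℝ) (p : Euc n),
        μ ^ q * ψ x z p ≤ ψ x (μ * max z 0) p) ∨
      (∃ ε : ℝ, 0 < ε ∧ ∀ x ∈ Ω, ∀ (z : ℝ) (p : Euc n),
        ε * ψ x z p ≤ deriv (fun s => ψ x s p) z)) :
    (∀ φ : Euc n → ℝ → Euc n → ℝ, IsC1On Ω φ →
      (∀ x ∈ Ω, ∀ (z : ℝ) (p : Euc n), φ x z p ≤ ψ x z p) →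
      ∀ u v : Euc n → ℝ, KConvexOn k Ω u → StrictKConvexOn k Ω v →
        BlowsUpAtBoundary Ω u → BlowsUpAtBoundary Ω v →
        IsSubsolution k Ω ψ u → IsSupersolution k Ω φ v →
        ∀ x ∈ Ω, u x ≤ v x) ∧
    (∀ u v : Euc n → ℝ, StrictKConvexOn k Ω u → StrictKConvexOn k Ω v →
      SolvesBlowUpProblem k Ω ψ u → SolvesBlowUpProblem k Ω ψ v →
      ∀ x ∈ Ω, u x = v x) := by
  have main : ∀ φ : Euc n → ℝ → Euc n → ℝ,
      (∀ x ∈ Ω, ∀ (z : ℝ) (p : Euc n), φ x z p ≤ ψ x z p) →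
      ∀ u v : Euc n → ℝ, KConvexOn k Ω u → StrictKConvexOn k Ω v → BlowsUpAtBoundary Ω v →
        IsSubsolution k Ω ψ u → IsSupersolution k Ω φ v → ∀ x ∈ Ω, u x ≤ v x := by
    intro φ hφψ u v hu hv hblow hsub hsup x hx
    rcases hψz with ⟨q, hq, hgrow⟩ | ⟨ε, hε, hgrow⟩
    · refine le_of_dilation_growth hkn.le hΩo hΩb hstar hψ hψx hψp
        (c := fun t => t ^ ((2 * k + 1) / (q - k))) (d := fun _ => 0)
        (tendsto_rpow_const_nhdsLT_one _) tendsto_const_nhds (fun t ht => ?_)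
        (fun t ht y hy z z' p hpos hz => ?_) hφψ hu hv hblow hsub hsup hx
      · have hqk : 0 < q - k := sub_pos.2 hq
        exact ⟨Real.rpow_pos_of_pos ht.1 _, Real.rpow_le_one ht.1.le ht.2.le (by positivity)⟩
      · rw [sub_zero] at hz
        exact lt_of_power_growth hq (g := fun s => ψ y s p)
          (fun μ hμ s => hgrow μ hμ y hy s p) ht hpos hz
    · refine le_of_dilation_growth hkn.le hΩo hΩb hstar hψ hψx hψp
        (c := fun _ => 1) (d := fun t => -(2 * k / ε) * Real.log t)
        tendsto_const_nhds ?_ (fun t _ => ⟨one_pos, le_rfl⟩)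
        (fun t ht y hy z z' p hpos hz => ?_) hφψ hu hv hblow hsub hsup hx
      · have h := ((Real.continuousAt_log one_ne_zero).tendsto).const_mul (-(2 * k / ε))
        rw [Real.log_one, mul_zero] at h
        exact h.mono_left nhdsWithin_le_nhds
      · rw [one_mul] at hz ⊢
        exact lt_of_exp_growth hε (g := fun s => ψ y s p)
          (fun z z' => exp_mul_le_of_mul_le_deriv hΩo hψ hy fun s => hgrow y hy s p) ht hpos hz
  refine ⟨fun φ _ hφψ u v hu hv _ hblow hsub hsup => main φ hφψ u v hu hv hblow hsub hsup,
    fun u v hu hv hsu hsv x hx => ?_⟩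
  have hle (u v : Euc n → ℝ) (hu : StrictKConvexOn k Ω u) (hv : StrictKConvexOn k Ω v)
      (hsu : SolvesBlowUpProblem k Ω ψ u) (hsv : SolvesBlowUpProblem k Ω ψ v) : u x ≤ v x :=
    main ψ (fun _ _ _ _ => le_rfl) u v ⟨hu.1, fun y hy => subset_closure (hu.2 y hy)⟩ hv hsv.2
      (fun y hy => (hsu.1 y hy).ge) (fun y hy => (hsv.1 y hy).le) x hx
  exact le_antisymm (hle u v hu hv hsu hsv) (hle v u hv hu hsv hsu)
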